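/- Let $p\ge 3$ be a prime and let $\mathbb F_p$ be the field with $p$ elements. A direction in the affine plane $\mathbb F_p^2$ is a pencil of $p$ parallel lines, so that there are $p+1$ directions. Given a function $w\colon\mathbb F_p^2\to\mathbb R$, a direction is called perfect with respect to $w$ if for every line $l$ in this direction $$\sum_{z\in l} w(z)=\frac1p\sum_{z\in\mathbb F_p^2} w(z).$$ If $S\subseteq\mathbb F_p^2$ is nonempty, then for any function $w\colon\mathbb F_p^2\to\mathbb R$ with $\operatorname{supp} w=S$ there are at most $\frac12|S|$ directions that are perfect with respect to $w$, unless $S$ is a line and $w$ is constant on $S$, in which case there are exactly $p$ perfect directions. -/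

import Mathlib

/-- The affine plane `F_p^2`. -/
abbrev Plane (p : ℕ) : Type := Fin 2 → ZMod p

/-- A line in the affine plane: an affine subspace of dimension `1`. -/
def IsLine {p : ℕ} (l : AffineSubspace (ZMod p) (Plane p)) : Prop :=
  (l : Set (Plane p)).Nonempty ∧ Module.finrank (ZMod p) l.direction = 1

/-- The pencil of all lines parallel to the one-dimensional linear subspace `H`. -/
def pencil {p : ℕ} (H : Submodule (ZMod p) (Plane p)) :
    Set (AffineSubspace (ZMod p) (Plane p)) :=
  {l | IsLine l ∧ l.direction = H}

/-- A direction is a pencil of parallel lines; pencils are in bijection with the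
one-dimensional linear subspaces of the plane, and so are represented by these. -/
def Direction (p : ℕ) : Type :=
  {H : Submodule (ZMod p) (Plane p) // Module.finrank (ZMod p) H = 1}

open Classical in
/-- The mass `∑_{z ∈ l} w(z)` that a line `l` carries. -/
noncomputable def lineMass {p : ℕ} [NeZero p] (w : Plane p → ℝ)
    (l : AffineSubspace (ZMod p) (Plane p)) : ℝ :=
  ∑ z with z ∈ l, w z

/-- A direction is perfect with respect to `w` if each of its lines carries exactly `1 / p`
of the total mass of `w`. -/
def IsPerfect {p : ℕ} [NeZero p] (w : Plane p → ℝ) (d : Direction p) : Prop :=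
  ∀ l ∈ pencil d.1, lineMass w l = 1 / (p : ℝ) * ∑ z, w z

/-- The set of all directions that are perfect with respect to `w`. -/
def perfectDirections {p : ℕ} [NeZero p] (w : Plane p → ℝ) : Set (Direction p) :=
  {d | IsPerfect w d}

/-- `S` is a line and `w` is constant on `S`. -/
def IsConstantOnLine {p : ℕ} (w : Plane p → ℝ) (S : Set (Plane p)) : Prop :=
  (∃ l : AffineSubspace (ZMod p) (Plane p), IsLine l ∧ (l : Set (Plane p)) = S) ∧
    ∃ c : ℝ, ∀ z ∈ S, w z = c

/-! Suppose more than half as many directions are perfect as the support has points, and at most `p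
- 1` are. Choose a valuation ring of the reals with `p` in its maximal ideal, scale `w` into it with
some value equal to `1`, and reduce to characteristic `p`. There `∑ c, c ^ j = 0` for `j < p - 1`,
so equal line masses kill the low moments of every perfect slope form. Interpolation in the slope
then shows that the reduced weight annihilates all polynomials of degree less than the number of
perfect directions (`annihilates_of_levelMass`). A nonzero weight with this property and so few
points lives on a line (`Annihilates.exists_line`), and equal masses make it constant there
(`exists_eq_indicator_line`).

To lift this to the reals (`IsBalanced.exists_eq_indicator`), subtract the indicator of that line.
If the difference is nonzero, rescale and reduce it as well, which gives a second line. The sum and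
the difference of the two scaled weights must also reduce to constants on lines, so the two
constants are both equal and opposite, which is impossible for odd `p`.

With `p` or `p + 1` perfect directions, inverting the line sums (`mul_eq_levelMass`) settles the
claim directly. -/

/-- The linear form whose level sets are the lines in the direction with parameter `i`: the
vertical direction has parameter `none`, and the direction of slope `m` has parameter `some m`. -/
def slopeForm {p : ℕ} : Option (ZMod p) → (Plane p →ₗ[ZMod p] ZMod p)
  | none => LinearMap.proj 0
  | some m => LinearMap.proj 1 - m • LinearMap.proj 0

/-! ### Incidence geometry of the plane and line masses. -/

section SlopeForm

variable {p : ℕ}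

@[simp]
theorem slopeForm_none (z : Plane p) : slopeForm none z = z 0 := rfl

@[simp]
theorem slopeForm_some (m : ZMod p) (z : Plane p) : slopeForm (some m) z = z 1 - m * z 0 := rfl

theorem slopeForm_surjective (i : Option (ZMod p)) :
    Function.Surjective (slopeForm i : Plane p → ZMod p) := by
  intro c
  cases i with
  | none => exact ⟨![c, 0], by simp⟩
  | some m => exact ⟨![0, c], by simp⟩

variable [Fact p.Prime]

/-- Two points on two distinct common lines coincide. -/
theorem eq_of_slopeForm_eq {i j : Option (ZMod p)} (hij : i ≠ j) {a b : Plane p}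
    (hi : slopeForm i a = slopeForm i b) (hj : slopeForm j a = slopeForm j b) : a = b := by
  have key : a 0 = b 0 ∧ a 1 = b 1 := by
    rcases i with _ | m <;> rcases j with _ | n
    · exact absurd rfl hij
    · simp only [slopeForm_none, slopeForm_some] at hi hj
      refine ⟨hi, ?_⟩
      rw [hi] at hj
      exact sub_left_injective hj
    · simp only [slopeForm_none, slopeForm_some] at hi hj
      refine ⟨hj, ?_⟩
      rw [hj] at hi
      exact sub_left_injective hi
    · simp only [slopeForm_some] at hi hj
      have hmn : m - n ≠ 0 := fun h => hij (congrArg some (sub_eq_zero.mp h))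
      have h0 : a 0 = b 0 := by
        have : (m - n) * (a 0 - b 0) = 0 := by linear_combination hj - hi
        exact sub_eq_zero.mp ((mul_eq_zero.mp this).resolve_left hmn)
      refine ⟨h0, ?_⟩
      rw [h0] at hi
      exact sub_left_injective hi
  ext t
  fin_cases t
  · exact key.1
  · exact key.2

/-- Any two points lie on a common line. -/
theorem exists_slopeForm_eq (a b : Plane p) : ∃ i, slopeForm i a = slopeForm i b := by
  by_cases h : a 0 = b 0
  · exact ⟨none, by simpa using h⟩
  · refine ⟨some ((a 1 - b 1) / (a 0 - b 0)), ?_⟩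
    have : a 0 - b 0 ≠ 0 := sub_ne_zero.mpr h
    simp only [slopeForm_some]
    field_simp
    ring

/-- There are two different directions, so distinct points are separated by some form. -/
theorem exists_slopeForm_ne {a b : Plane p} (hab : a ≠ b) : ∃ i, slopeForm i a ≠ slopeForm i b := by
  by_contra! h
  exact hab (eq_of_slopeForm_eq (i := none) (j := some 0) (by simp) (h _) (h _))

/-- Lines in different directions meet. -/
theorem exists_slopeForm_eq_and {i j : Option (ZMod p)} (hij : i ≠ j) (c d : ZMod p) :
    ∃ z, slopeForm i z = c ∧ slopeForm j z = d := by
  have hinj : Function.Injective (fun z : Plane p => (slopeForm i z, slopeForm j z)) := by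
    intro a b hab
    exact eq_of_slopeForm_eq hij (congrArg Prod.fst hab) (congrArg Prod.snd hab)
  -- Both sides have `p ^ 2` elements, so injectivity suffices.
  have hbij := (Fintype.bijective_iff_injective_and_card _).mpr ⟨hinj, by simp [sq]⟩
  obtain ⟨z, hz⟩ := hbij.2 (c, d)
  exact ⟨z, congrArg Prod.fst hz, congrArg Prod.snd hz⟩

/-- A line has `p` points. -/
theorem card_slopeForm_eq (i : Option (ZMod p)) (c : ZMod p) :
    (Finset.univ.filter fun z : Plane p => slopeForm i z = c).card = p := by
  obtain ⟨j, hij⟩ : ∃ j : Option (ZMod p), i ≠ j := by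
    cases i with
    | none => exact ⟨some 0, by simp⟩
    | some m => exact ⟨none, by simp⟩
  have : (Finset.univ.filter fun z : Plane p => slopeForm i z = c).card
      = (Finset.univ : Finset (ZMod p)).card := by
    refine Finset.card_bij (fun z _ => slopeForm j z) (fun _ _ => Finset.mem_univ _) ?_ ?_
    · intro a ha b hb h
      exact eq_of_slopeForm_eq hij
        ((Finset.mem_filter.mp ha).2.trans (Finset.mem_filter.mp hb).2.symm) h
    · intro d _
      obtain ⟨z, h1, h2⟩ := exists_slopeForm_eq_and hij c d
      exact ⟨z, by simp [h1], h2⟩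
  simpa using this

/-- A level set of a slope form contained in another one of the same plane equals it. -/
theorem slopeForm_level_subset {i j : Option (ZMod p)} {c d : ZMod p}
    (h : ∀ z : Plane p, slopeForm i z = c → slopeForm j z = d) (z : Plane p)
    (hz : slopeForm j z = d) : slopeForm i z = c := by
  have hsub : (Finset.univ.filter fun z : Plane p => slopeForm i z = c) ⊆
      Finset.univ.filter fun z : Plane p => slopeForm j z = d :=
    Finset.monotone_filter_right _ fun z _ => h z
  have := Finset.eq_of_subset_of_card_le hsub (by rw [card_slopeForm_eq, card_slopeForm_eq])
  have hz' : z ∈ Finset.univ.filter fun z : Plane p => slopeForm j z = d := by simp [hz]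
  rw [← this] at hz'
  exact (Finset.mem_filter.mp hz').2

theorem finrank_ker_slopeForm (i : Option (ZMod p)) :
    Module.finrank (ZMod p) (LinearMap.ker (slopeForm i : Plane p →ₗ[ZMod p] ZMod p)) = 1 := by
  have h := LinearMap.finrank_range_add_finrank_ker (slopeForm i : Plane p →ₗ[ZMod p] ZMod p)
  rw [LinearMap.range_eq_top.mpr (slopeForm_surjective i)] at h
  simp only [finrank_top, Module.finrank_self, Module.finrank_fin_fun] at h
  omega

/-- Every one-dimensional subspace of the plane is the kernel of a unique slope form. -/
noncomputable def directionEquiv : Option (ZMod p) ≃ Direction p :=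
  Equiv.ofBijective (fun i => ⟨LinearMap.ker (slopeForm i), finrank_ker_slopeForm i⟩) (by
    constructor
    · intro i j hij
      by_contra hne
      have hker : LinearMap.ker (slopeForm i : Plane p →ₗ[ZMod p] ZMod p)
          = LinearMap.ker (slopeForm j) := congrArg Subtype.val hij
      obtain ⟨z, hz1, hz2⟩ := exists_slopeForm_eq_and hne (0 : ZMod p) 1
      have : z ∈ LinearMap.ker (slopeForm j : Plane p →ₗ[ZMod p] ZMod p) := by
        rw [← hker]; exact hz1
      rw [LinearMap.mem_ker, hz2] at this
      exact one_ne_zero this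
    · rintro ⟨H, hH⟩
      obtain ⟨v, -, hv⟩ := finrank_eq_one_iff'.mp hH
      obtain ⟨i, hi⟩ := exists_slopeForm_eq (v : Plane p) 0
      rw [map_zero] at hi
      refine ⟨i, Subtype.ext ?_⟩
      symm
      refine Submodule.eq_of_le_of_finrank_eq ?_ (by rw [hH, finrank_ker_slopeForm])
      intro x hx
      obtain ⟨c, hc⟩ := hv ⟨x, hx⟩
      have hx' : x = c • (v : Plane p) := (congrArg Subtype.val hc).symm
      rw [LinearMap.mem_ker, hx', map_smul, hi, smul_zero])

/-- The mass of the line `slopeForm i = c`. -/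
def levelMass {M : Type*} [AddCommMonoid M] (u : Plane p → M) (i : Option (ZMod p))
    (c : ZMod p) : M :=
  ∑ z with slopeForm i z = c, u z

theorem mem_iff_of_direction_eq {l : AffineSubspace (ZMod p) (Plane p)} {i : Option (ZMod p)}
    (hl : l.direction = LinearMap.ker (slopeForm i)) {z₀ : Plane p} (h₀ : z₀ ∈ l) (z : Plane p) :
    z ∈ l ↔ slopeForm i z = slopeForm i z₀ := by
  rw [← AffineSubspace.vsub_right_mem_direction_iff_mem h₀, hl, LinearMap.mem_ker, vsub_eq_sub,
    map_sub, sub_eq_zero]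

theorem exists_line (i : Option (ZMod p)) (c : ZMod p) :
    ∃ l ∈ pencil (directionEquiv i).1, ∀ z, z ∈ l ↔ slopeForm i z = c := by
  obtain ⟨z₀, rfl⟩ := slopeForm_surjective i c
  have hd : (AffineSubspace.mk' z₀ (directionEquiv i).1).direction = (directionEquiv i).1 :=
    AffineSubspace.direction_mk' _ _
  refine ⟨AffineSubspace.mk' z₀ (directionEquiv i).1,
    ⟨⟨⟨z₀, AffineSubspace.self_mem_mk' _ _⟩, ?_⟩, hd⟩, fun z => ?_⟩
  · rw [hd]
    exact (directionEquiv i).2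
  · exact mem_iff_of_direction_eq hd (AffineSubspace.self_mem_mk' _ _) z

theorem IsLine.exists_slopeForm {l : AffineSubspace (ZMod p) (Plane p)} (hl : IsLine l) :
    ∃ i c, (directionEquiv i).1 = l.direction ∧ ∀ z, z ∈ l ↔ slopeForm i z = c := by
  obtain ⟨⟨z₀, h₀⟩, hf⟩ := hl
  obtain ⟨i, hi⟩ := directionEquiv.surjective ⟨l.direction, hf⟩
  have hi' : (directionEquiv i).1 = l.direction := congrArg Subtype.val hi
  exact ⟨i, slopeForm i z₀, hi', mem_iff_of_direction_eq hi'.symm h₀⟩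

theorem lineMass_eq_levelMass {w : Plane p → ℝ} {l : AffineSubspace (ZMod p) (Plane p)}
    {i : Option (ZMod p)} {c : ZMod p} (h : ∀ z, z ∈ l ↔ slopeForm i z = c) :
    lineMass w l = levelMass w i c := by
  classical
  unfold lineMass levelMass
  exact Finset.sum_congr (by ext z; simp [h]) fun _ _ => rfl

theorem isPerfect_directionEquiv_iff (w : Plane p → ℝ) (i : Option (ZMod p)) :
    IsPerfect w (directionEquiv i) ↔ ∀ c, levelMass w i c = 1 / (p : ℝ) * ∑ z, w z := by
  constructor
  · intro h c
    obtain ⟨l, hl, hm⟩ := exists_line i c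
    rw [← lineMass_eq_levelMass hm]
    exact h l hl
  · rintro h l ⟨⟨⟨z₀, h₀⟩, -⟩, hd⟩
    rw [lineMass_eq_levelMass (mem_iff_of_direction_eq hd h₀)]
    exact h _

theorem isConstantOnLine_iff (w : Plane p → ℝ) (S : Set (Plane p)) :
    IsConstantOnLine w S ↔
      (∃ i c, S = {z | slopeForm i z = c}) ∧ ∃ a : ℝ, ∀ z ∈ S, w z = a := by
  refine and_congr_left fun _ => ⟨?_, ?_⟩
  · rintro ⟨l, hl, rfl⟩
    obtain ⟨i, c, -, h⟩ := hl.exists_slopeForm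
    exact ⟨i, c, Set.ext h⟩
  · rintro ⟨i, c, rfl⟩
    obtain ⟨l, hl, h⟩ := exists_line i c
    exact ⟨l, hl.1, Set.ext h⟩

/-- The mass of a weighted line on the lines of another direction. -/
theorem levelMass_indicator_of_ne {M : Type*} [AddCommMonoid M] {i j : Option (ZMod p)}
    (hij : i ≠ j) (c d : ZMod p) (a : M) :
    levelMass (fun z => if slopeForm j z = d then a else 0) i c = a := by
  obtain ⟨z, h1, h2⟩ := exists_slopeForm_eq_and hij c d
  unfold levelMass
  rw [Finset.sum_eq_single_of_mem z (by simp [h1])]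
  · simp [h2]
  · intro b hb hbz
    rw [if_neg]
    intro hb2
    exact hbz (eq_of_slopeForm_eq hij ((Finset.mem_filter.mp hb).2.trans h1.symm)
      (hb2.trans h2.symm))

/-- Summing the masses of the lines through a point counts this point `p + 1` times and
every other point once. -/
theorem sum_levelMass (w : Plane p → ℝ) (z : Plane p) :
    ∑ i, levelMass w i (slopeForm i z) = p * w z + ∑ x, w x := by
  have h1 : ∀ x : Plane p, (∑ i, if slopeForm i x = slopeForm i z then w x else 0)
      = (if x = z then p * w z else 0) + w x := by
    intro x
    split_ifs with h
    · subst h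
      simp [add_mul]
    · obtain ⟨i, hi⟩ := exists_slopeForm_eq x z
      rw [Finset.sum_eq_single_of_mem i (Finset.mem_univ _), if_pos hi, zero_add]
      intro j _ hj
      rw [if_neg]
      exact fun hj' => h (eq_of_slopeForm_eq hj hj' hi)
  simp only [levelMass, Finset.sum_filter]
  rw [Finset.sum_comm, Finset.sum_congr rfl fun x _ => h1 x, Finset.sum_add_distrib]
  simp

theorem sum_levelMass_level {M : Type*} [AddCommMonoid M] (w : Plane p → M)
    (i : Option (ZMod p)) : ∑ c, levelMass w i c = ∑ z, w z :=
  Finset.sum_fiberwise _ _ _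

end SlopeForm

/-! ### The polynomial method in characteristic `p`. -/

section Annihilate

variable {p : ℕ} [Fact p.Prime] {F : Type*} [Field F]

/-- The weight `w` annihilates all polynomials in two variables of degree at most `d`. -/
def Annihilates (ι : ZMod p →+* F) (w : Plane p → F) (d : ℕ) : Prop :=
  ∀ a b, a + b ≤ d → ∑ z, w z * ι (z 0) ^ a * ι (z 1) ^ b = 0

theorem Annihilates.sum_eq_zero {ι : ZMod p →+* F} {w : Plane p → F} {d : ℕ}
    (h : Annihilates ι w d) : ∑ z, w z = 0 := by
  simpa using h 0 0 (Nat.zero_le _)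

/-- Multiplication by an affine form lowers the degree of annihilation by one. -/
theorem Annihilates.mul_slopeForm {ι : ZMod p →+* F} {w : Plane p → F} {d : ℕ}
    (h : Annihilates ι w (d + 1)) (i : Option (ZMod p)) (c : ZMod p) :
    Annihilates ι (fun z => w z * ι (slopeForm i z - c)) d := by
  intro a b hab
  have h0 := h a b (by omega)
  have h1 := h (a + 1) b (by omega)
  have h2 := h a (b + 1) (by omega)
  cases i with
  | none =>
    calc _ = ∑ z, (w z * ι (z 0) ^ (a + 1) * ι (z 1) ^ b
          - ι c * (w z * ι (z 0) ^ a * ι (z 1) ^ b)) := by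
          refine Finset.sum_congr rfl fun z _ => ?_
          simp only [slopeForm_none, map_sub]
          ring
      _ = 0 := by rw [Finset.sum_sub_distrib, ← Finset.mul_sum, h0, h1]; simp
  | some m =>
    calc _ = ∑ z, (w z * ι (z 0) ^ a * ι (z 1) ^ (b + 1)
          - ι m * (w z * ι (z 0) ^ (a + 1) * ι (z 1) ^ b)
          - ι c * (w z * ι (z 0) ^ a * ι (z 1) ^ b)) := by
          refine Finset.sum_congr rfl fun z _ => ?_
          simp only [slopeForm_some, map_sub, map_mul]
          ring
      _ = 0 := by
          rw [Finset.sum_sub_distrib, Finset.sum_sub_distrib, ← Finset.mul_sum, ← Finset.mul_sum,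
            h0, h1, h2]
          simp

theorem mul_slopeForm_eq_zero_iff (ι : ZMod p →+* F) {w : Plane p → F} {i : Option (ZMod p)}
    {c : ZMod p} {z : Plane p} :
    w z * ι (slopeForm i z - c) = 0 ↔ w z = 0 ∨ slopeForm i z = c := by
  rw [mul_eq_zero, map_eq_zero, sub_eq_zero]

/-- At most `d + 1` points impose independent conditions on polynomials of degree `d`. -/
theorem Annihilates.eq_zero {ι : ZMod p →+* F} {d : ℕ} : ∀ {w : Plane p → F} {S : Finset (Plane p)},
    Annihilates ι w d → (∀ z ∉ S, w z = 0) → S.card ≤ d + 1 → w = 0 := by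
  classical
  induction d with
  | zero =>
    intro w S h hS hcard
    funext z
    by_contra hz
    have hzS : z ∈ S := by
      by_contra hzS
      exact hz (hS z hzS)
    refine hz ?_
    rw [Pi.zero_apply, ← h.sum_eq_zero, Finset.sum_eq_single_of_mem z (Finset.mem_univ _)]
    intro b _ hb
    exact hS b fun hbS => hb (Finset.card_le_one.mp hcard b hbS z hzS)
  | succ d ih =>
    intro w S h hS hcard
    funext z
    by_contra hz
    obtain ⟨y, hyz, hy⟩ : ∃ y, y ≠ z ∧ w y ≠ 0 := by
      by_contra! hall
      refine hz ?_
      rw [Pi.zero_apply, ← h.sum_eq_zero,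
        Finset.sum_eq_single_of_mem z (Finset.mem_univ _) fun b _ hb => hall b hb]
    have hyS : y ∈ S := by
      by_contra hyS
      exact hy (hS y hyS)
    -- Multiplying by a form that vanishes at `y` but not at `z` removes one point at the cost of
    -- one degree.
    obtain ⟨i, hi⟩ := exists_slopeForm_ne hyz
    have := ih (S := S.erase y) (h.mul_slopeForm i (slopeForm i y)) (fun x hx => by
      rw [mul_slopeForm_eq_zero_iff]
      by_cases hxy : x = y
      · exact Or.inr (by rw [hxy])
      · exact Or.inl (hS x fun hxS => hx (Finset.mem_erase.mpr ⟨hxy, hxS⟩)))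
      (by rw [Finset.card_erase_of_mem hyS]; omega)
    rcases (mul_slopeForm_eq_zero_iff ι).mp (congrFun this z) with h' | h'
    · exact hz h'
    · exact hi h'.symm

/-- At most `2 * d + 1` points, all of which are needed in a dependency between the conditions
they impose on polynomials of degree `d`, are collinear. -/
theorem Annihilates.exists_line {ι : ZMod p →+* F} {d : ℕ} :
    ∀ {w : Plane p → F} {S : Finset (Plane p)},
    Annihilates ι w d → (∀ z ∉ S, w z = 0) → S.card ≤ 2 * d + 1 →
    ∃ i c, ∀ z, w z ≠ 0 → slopeForm i z = c := by
  classical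
  induction d with
  | zero =>
    intro w S h hS hcard
    have := h.eq_zero hS hcard
    exact ⟨none, 0, fun z hz => absurd (congrFun this z) hz⟩
  | succ d ih =>
    intro w S h hS hcard
    by_cases hex : ∃ x y, x ≠ y ∧ w x ≠ 0 ∧ w y ≠ 0
    swap
    · push Not at hex
      by_cases hx : ∃ x, w x ≠ 0
      · obtain ⟨x, hx⟩ := hx
        refine ⟨none, slopeForm none x, fun z hz => ?_⟩
        by_contra hne
        exact hz (hex x z (fun hxz => hne (by rw [hxz])) hx)
      · push Not at hx
        exact ⟨none, 0, fun z hz => absurd (hx z) hz⟩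
    obtain ⟨x, y, hxy, hx, hy⟩ := hex
    have hmem : ∀ z, w z ≠ 0 → z ∈ S := fun z hz => by
      by_contra hzS
      exact hz (hS z hzS)
    obtain ⟨i, hi⟩ := exists_slopeForm_eq x y
    set c := slopeForm i x with hc
    have hS' : ∀ (j : Option (ZMod p)) (e : ZMod p), ∀ z ∉ S.filter (fun z => slopeForm j z ≠ e),
        w z * ι (slopeForm j z - e) = 0 := by
      intro j e z hz
      rw [mul_slopeForm_eq_zero_iff]
      by_contra! hne
      exact hz (Finset.mem_filter.mpr ⟨hmem z hne.1, hne.2⟩)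
    -- The line through `x` and `y` removes at least two points, matching the drop from `2 * (d + 1)
    -- + 1` to `2 * d + 1`.
    have hcard' : (S.filter fun z => slopeForm i z ≠ c).card ≤ 2 * d + 1 := by
      have hsub : S.filter (fun z => slopeForm i z ≠ c) ⊆ (S.erase x).erase y := by
        intro z hz
        rw [Finset.mem_filter] at hz
        refine Finset.mem_erase.mpr ⟨?_, Finset.mem_erase.mpr ⟨?_, hz.1⟩⟩
        · rintro rfl
          exact hz.2 hi.symm
        · rintro rfl
          exact hz.2 rfl
      have := Finset.card_le_card hsub
      rw [Finset.card_erase_of_mem (Finset.mem_erase.mpr ⟨hxy.symm, hmem y hy⟩),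
        Finset.card_erase_of_mem (hmem x hx)] at this
      omega
    have hann := h.mul_slopeForm i c
    obtain ⟨j, e, hje⟩ := ih hann (hS' i c) hcard'
    by_cases hzero : (fun z => w z * ι (slopeForm i z - c)) = 0
    · refine ⟨i, c, fun z hz => ?_⟩
      exact ((mul_slopeForm_eq_zero_iff ι).mp (congrFun hzero z)).resolve_left hz
    refine ⟨j, e, fun z hz => ?_⟩
    -- The nonzero product is supported on the line `(j, e)` and needs at least `d + 2` points. This
    -- leaves at most `d + 1` points of `S` off that line, too few for a nonzero weight once `w` is
    -- multiplied by the form of that line.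
    have hbig : d + 2 ≤ (S.filter fun z => slopeForm j z = e).card := by
      by_contra! hlt
      refine hzero (hann.eq_zero (S := S.filter fun z => slopeForm j z = e) ?_ (by omega))
      intro z hz
      by_contra hne
      have hwz : w z ≠ 0 := fun h0 => hne (by simp [h0])
      exact hz (Finset.mem_filter.mpr ⟨hmem z hwz, hje z hne⟩)
    have hsplit := Finset.card_filter_add_card_filter_not (s := S) (fun z => slopeForm j z = e)
    have := (h.mul_slopeForm j e).eq_zero (hS' j e) (by
      have : (S.filter fun z => slopeForm j z ≠ e).card
        = (S.filter fun z => ¬ slopeForm j z = e).card := rfl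
      omega)
    exact ((mul_slopeForm_eq_zero_iff ι).mp (congrFun this z)).resolve_left hz

/-- The low power moments vanish in every direction all of whose lines carry the same mass. -/
theorem sum_mul_slopeForm_pow {ι : ZMod p →+* F} {w : Plane p → F} {i : Option (ZMod p)} {L : F}
    (h : ∀ c, levelMass w i c = L) {j : ℕ} (hj : j < p - 1) :
    ∑ z, w z * ι (slopeForm i z) ^ j = 0 := by
  calc ∑ z, w z * ι (slopeForm i z) ^ j
      = ∑ c, ∑ z with slopeForm i z = c, w z * ι (slopeForm i z) ^ j :=
        (Finset.sum_fiberwise _ _ _).symm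
    _ = ∑ c, L * ι (c ^ j) := by
        refine Finset.sum_congr rfl fun c _ => ?_
        rw [← h c, levelMass, Finset.sum_mul]
        refine Finset.sum_congr rfl fun z hz => ?_
        rw [(Finset.mem_filter.mp hz).2, map_pow]
    _ = 0 := by
        rw [← Finset.mul_sum, ← map_sum, FiniteField.sum_pow_lt_card_sub_one _ j (by simpa using hj)]
        simp

/-- A weight with the same mass on all lines in `d + 1` directions annihilates the polynomials
of degree at most `d`. -/
theorem annihilates_of_levelMass {ι : ZMod p →+* F} {w : Plane p → F}
    {D : Finset (Option (ZMod p))} {L : F} (h : ∀ i ∈ D, ∀ c, levelMass w i c = L) {d : ℕ}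
    (hdp : d < p - 1) (hdD : d < D.card) : Annihilates ι w d := by
  classical
  intro a b hab
  obtain ⟨j, rfl⟩ : ∃ j, j = a + b := ⟨_, rfl⟩
  -- These are the coefficients of the moment of order `a + b` as a polynomial in the slope; `M a`
  -- is the wanted sum up to a unit.
  set M : ℕ → F := fun m => ∑ z, w z * (-ι (z 0)) ^ m * ι (z 1) ^ (a + b - m) * (a + b).choose m
    with hM
  set Q : Polynomial F := ∑ m ∈ Finset.range (a + b + 1), Polynomial.monomial m (M m) with hQ
  have hcoeff : ∀ m, Q.coeff m = if m < a + b + 1 then M m else 0 := by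
    intro m
    simp [hQ, Polynomial.coeff_monomial]
  have heval : ∀ x : F, Q.eval x = ∑ z, w z * (ι (z 1) - x * ι (z 0)) ^ (a + b) := by
    intro x
    rw [hQ, Polynomial.eval_finsetSum]
    simp only [Polynomial.eval_monomial, hM, Finset.sum_mul]
    rw [Finset.sum_comm]
    refine Finset.sum_congr rfl fun z _ => ?_
    rw [sub_eq_neg_add, add_pow, Finset.mul_sum]
    refine Finset.sum_congr rfl fun m _ => ?_
    rw [neg_mul_eq_mul_neg, mul_pow]
    ring
  have hQ0 : Q = 0 := by
    refine Polynomial.eq_zero_of_degree_lt_of_eval_finset_eq_zero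
      (D.eraseNone.map ⟨ι, ι.injective⟩) ?_ ?_
    · rw [Polynomial.degree_lt_iff_coeff_zero, Finset.card_map]
      intro m hm
      rw [hcoeff]
      split_ifs with hlt
      swap
      · rfl
      -- If the vertical direction is in `D`, there is one root fewer; its own moment is, up to
      -- sign, the top coefficient, which therefore vanishes and lowers the degree to match.
      have hnone : none ∈ D := by
        by_contra hnone
        rw [Finset.card_eraseNone_of_not_mem hnone] at hm
        omega
      rw [Finset.card_eraseNone_of_mem hnone] at hm
      have hm' : m = a + b := by omega
      subst hm'
      have h0 := sum_mul_slopeForm_pow (ι := ι) (h none hnone) (j := a + b) (by omega)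
      simp only [slopeForm_none] at h0
      simp only [hM, Nat.sub_self, pow_zero, mul_one, Nat.choose_self, Nat.cast_one]
      calc _ = (-1) ^ (a + b) * ∑ z, w z * ι (z 0) ^ (a + b) := by
            rw [Finset.mul_sum]
            refine Finset.sum_congr rfl fun z _ => ?_
            rw [neg_pow]
            ring
        _ = 0 := by rw [h0, mul_zero]
    · intro x hx
      obtain ⟨m, hm, rfl⟩ := Finset.mem_map.mp hx
      have h0 := sum_mul_slopeForm_pow (ι := ι) (h _ (Finset.mem_eraseNone.mp hm)) (j := a + b)
        (by omega)
      rw [heval]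
      simpa using h0
  have hMa := hcoeff a
  rw [hQ0, Polynomial.coeff_zero, if_pos (by omega)] at hMa
  -- Here `a + b < p`, so `p` does not divide the binomial coefficient.
  have hchoose : ((a + b).choose a : F) ≠ 0 := by
    have h1 : ¬ p ∣ (a + b).choose a := fun hdvd =>
      absurd (((Fact.out : p.Prime).dvd_factorial).mp
        (hdvd.trans ⟨a.factorial * b.factorial, by
          rw [← mul_assoc, Nat.choose_symm_add]; exact (Nat.add_choose_mul_factorial_mul_factorial a b).symm⟩))
        (by omega)
    have h2 : ((a + b).choose a : ZMod p) ≠ 0 := by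
      rwa [Ne, ZMod.natCast_eq_zero_iff]
    have := (map_ne_zero ι).mpr h2
    rwa [map_natCast] at this
  have hfin : M a = ((-1) ^ a * (a + b).choose a) * ∑ z, w z * ι (z 0) ^ a * ι (z 1) ^ b := by
    rw [Finset.mul_sum]
    refine Finset.sum_congr rfl fun z _ => ?_
    rw [neg_pow, Nat.add_sub_cancel_left]
    ring
  rw [hfin] at hMa
  exact (mul_eq_zero.mp hMa.symm).resolve_left
    (mul_ne_zero (pow_ne_zero _ (neg_ne_zero.mpr one_ne_zero)) hchoose)

/-- In characteristic `p`, a nonzero weight with the same mass on all lines in more than half as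
many directions as its support has points is constant on a line and zero elsewhere. -/
theorem exists_eq_indicator_line (ι : ZMod p →+* F) {w : Plane p → F}
    {D : Finset (Option (ZMod p))} {L : F} (h : ∀ i ∈ D, ∀ c, levelMass w i c = L)
    (hD : D.card ≤ p - 1) {S : Finset (Plane p)} (hS : ∀ z ∉ S, w z = 0)
    (hcard : S.card < 2 * D.card) (hw : w ≠ 0) :
    ∃ i ∉ D, ∃ c, L ≠ 0 ∧ ∀ z, w z = if slopeForm i z = c then L else 0 := by
  classical
  obtain ⟨d, hd⟩ : ∃ d, D.card = d + 1 := ⟨D.card - 1, by omega⟩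
  have hann : Annihilates ι w d := annihilates_of_levelMass h (by omega) (by omega)
  obtain ⟨i, c, hic⟩ := hann.exists_line hS (by omega)
  have hd0 : d ≠ 0 := by
    rintro rfl
    exact hw (hann.eq_zero hS (by omega))
  -- Each line in a direction `j ≠ i` meets the supporting line once, so its mass `L` is the value
  -- at that point.
  obtain ⟨j, hj, hji⟩ := Finset.exists_mem_ne (by omega : 1 < D.card) i
  have hval : ∀ z, w z = if slopeForm i z = c then L else 0 := by
    intro z
    split_ifs with hz
    · rw [← h j hj (slopeForm j z), levelMass, Finset.sum_eq_single_of_mem z (by simp)]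
      intro b hb hbz
      by_contra hne
      exact hbz (eq_of_slopeForm_eq hji (Finset.mem_filter.mp hb).2 ((hic b hne).trans hz.symm))
    · by_contra hne
      exact hz (hic z hne)
  have hL : L ≠ 0 := by
    rintro rfl
    exact hw (funext fun z => by rw [hval]; simp)
  -- A parallel line, such as the level `c + 1`, carries no mass, so `i ∈ D` would force `L = 0`.
  refine ⟨i, fun hi => hL ?_, c, hL, hval⟩
  rw [← h i hi (c + 1), levelMass]
  refine Finset.sum_eq_zero fun z hz => ?_
  rw [hval, if_neg]
  rw [(Finset.mem_filter.mp hz).2]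
  simp

end Annihilate

/-! ### Reduction modulo a valuation above `p`, and lifting back. -/

section Valuation

variable {p : ℕ}

/-- The integers inside the reals have `p` as a nonunit, and a proper ideal of a subring extends
into the maximal ideal of some valuation ring. -/
theorem exists_valuationSubring_natCast_mem_nonunits (hp : p.Prime) :
    ∃ O : ValuationSubring ℝ, (p : ℝ) ∈ O.nonunits := by
  have hI : Ideal.span {((p : ℕ) : (Int.castRingHom ℝ).range)} ≠ ⊤ := by
    rw [Ne, Ideal.span_singleton_eq_top]
    intro h
    obtain ⟨⟨_, n, rfl⟩, hn⟩ := h.exists_right_inv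
    have h1 : (p : ℝ) * (n : ℝ) = 1 := by simpa using congrArg Subtype.val hn
    have h2 : (p : ℤ) * n = 1 := by exact_mod_cast h1
    have h3 : (p : ℤ) ∣ 1 := ⟨n, h2.symm⟩
    have h4 : p ∣ 1 := by exact_mod_cast h3
    exact hp.one_lt.ne' (Nat.dvd_one.mp h4)
  obtain ⟨O, -, hO⟩ := Ideal.image_subset_nonunits_valuationSubring _ hI
  exact ⟨O, hO ⟨_, Ideal.subset_span rfl, by simp⟩⟩

/-- A nonzero function on a finite type can be scaled into a valuation ring so that one of its
values is `1`. -/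
theorem ValuationSubring.exists_div_mem {K X : Type*} [Field K] [Finite X] (O : ValuationSubring K)
    {u : X → K} (hu : u ≠ 0) : ∃ y, u y ≠ 0 ∧ ∀ x, u x / u y ∈ O := by
  obtain ⟨x₀, hx₀⟩ := Function.ne_iff.mp hu
  have : Nonempty X := ⟨x₀⟩
  obtain ⟨y, hy⟩ := Finite.exists_max fun x => O.valuation (u x)
  have hy0 : u y ≠ 0 := by
    intro h
    have := hy x₀
    rw [h, map_zero, le_zero_iff, map_eq_zero] at this
    exact hx₀ this
  refine ⟨y, hy0, fun x => ?_⟩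
  rw [← O.valuation_le_one_iff, map_div₀]
  exact div_le_one_of_le₀ (hy x) zero_le

variable [Fact p.Prime]

/-- The weight `u` vanishes outside `S`, and has the same mass on all lines in the directions
from `D`. -/
def IsBalanced {M : Type*} [AddCommMonoid M] (D : Finset (Option (ZMod p)))
    (S : Finset (Plane p)) (u : Plane p → M) : Prop :=
  (∃ L, ∀ i ∈ D, ∀ c, levelMass u i c = L) ∧ ∀ z ∉ S, u z = 0

theorem IsBalanced.add {M : Type*} [AddCommMonoid M] {D : Finset (Option (ZMod p))}
    {S : Finset (Plane p)} {u v : Plane p → M} (hu : IsBalanced D S u) (hv : IsBalanced D S v) :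
    IsBalanced D S fun z => u z + v z := by
  obtain ⟨⟨L, hL⟩, hS⟩ := hu
  obtain ⟨⟨L', hL'⟩, hS'⟩ := hv
  refine ⟨⟨L + L', fun i hi c => ?_⟩, fun z hz => by simp [hS z hz, hS' z hz]⟩
  rw [← hL i hi c, ← hL' i hi c, levelMass, Finset.sum_add_distrib]
  rfl

theorem IsBalanced.map {M N G : Type*} [AddCommMonoid M] [AddCommMonoid N] [FunLike G M N]
    [AddMonoidHomClass G M N] {D : Finset (Option (ZMod p))}
    {S : Finset (Plane p)} {u : Plane p → M} (hu : IsBalanced D S u) (f : G) :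
    IsBalanced D S fun z => f (u z) := by
  obtain ⟨⟨L, hL⟩, hS⟩ := hu
  refine ⟨⟨f L, fun i hi c => ?_⟩, fun z hz => by simp [hS z hz]⟩
  rw [← hL i hi c, levelMass, levelMass, map_sum]

theorem IsBalanced.sub {M : Type*} [AddCommGroup M] {D : Finset (Option (ZMod p))}
    {S : Finset (Plane p)} {u v : Plane p → M} (hu : IsBalanced D S u) (hv : IsBalanced D S v) :
    IsBalanced D S fun z => u z - v z := by
  simp only [sub_eq_add_neg]
  exact hu.add (hv.map (negAddMonoidHom : M →+ M))

/-- A line meets each line of another direction exactly once. Hence subtracting it preserves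
balance, which is why `IsBalanced` leaves the common mass free. -/
theorem isBalanced_indicator {M : Type*} [AddCommMonoid M] {D : Finset (Option (ZMod p))}
    {S : Finset (Plane p)} {i : Option (ZMod p)} (hi : i ∉ D) {c : ZMod p}
    (hS : ∀ z, slopeForm i z = c → z ∈ S) (a : M) :
    IsBalanced D S fun z => if slopeForm i z = c then a else 0 := by
  refine ⟨⟨a, fun j hj d => levelMass_indicator_of_ne (ne_of_mem_of_not_mem hj hi) _ _ _⟩,
    fun z hz => if_neg fun h => hz (hS z h)⟩

/-- A nonzero balanced real weight can be scaled into a valuation ring. -/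
theorem IsBalanced.exists_scaled (O : ValuationSubring ℝ) {D : Finset (Option (ZMod p))}
    {S : Finset (Plane p)} (hD : D.Nonempty) {u : Plane p → ℝ} (hu : IsBalanced D S u)
    (hu0 : u ≠ 0) :
    ∃ v : Plane p → O, IsBalanced D S v ∧ (∃ y, v y = 1) ∧
      ∃ a : ℝ, a ≠ 0 ∧ ∀ z, (v z : ℝ) = a * u z := by
  obtain ⟨y, hy, hmem⟩ := O.exists_div_mem hu0
  obtain ⟨⟨L, hL⟩, hS⟩ := hu
  obtain ⟨i₀, hi₀⟩ := hD
  -- The common mass must be an element of `O`, so it is taken to be the mass of one particular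
  -- line.
  refine ⟨fun z => ⟨u z / u y, hmem z⟩, ⟨⟨levelMass (fun z => (⟨u z / u y, hmem z⟩ : O)) i₀ 0, ?_⟩,
    ?_⟩, ⟨y, Subtype.ext (div_self hy)⟩, (u y)⁻¹, inv_ne_zero hy, fun z => ?_⟩
  · have key : ∀ i ∈ D, ∀ c, O.subtype (levelMass (fun z => (⟨u z / u y, hmem z⟩ : O)) i c)
        = L / u y := by
      intro i hi c
      rw [levelMass, map_sum, ← hL i hi c, levelMass, Finset.sum_div]
      rfl
    intro i hi c
    exact O.subtype_injective ((key i hi c).trans (key i₀ hi₀ 0).symm)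
  · intro z hz
    exact Subtype.ext (by simp [hS z hz])
  · exact div_eq_inv_mul _ _

/-- The canonical map to a residue field of characteristic `p`. -/
theorem exists_ringHom_residueField {O : ValuationSubring ℝ} (hO : (p : ℝ) ∈ O.nonunits) :
    Nonempty (ZMod p →+* IsLocalRing.ResidueField O) := by
  have h0 : ((p : ℕ) : IsLocalRing.ResidueField O) = 0 := by
    rw [← map_natCast (IsLocalRing.residue O), IsLocalRing.residue_eq_zero_iff,
      ← ValuationSubring.coe_mem_nonunits_iff]
    simpa using hO
  have : CharP (IsLocalRing.ResidueField O) p := by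
    obtain ⟨q, hq⟩ := CharP.exists (IsLocalRing.ResidueField O)
    have hdvd := (CharP.cast_eq_zero_iff _ q p).mp h0
    rcases (Nat.dvd_prime Fact.out).mp hdvd with rfl | rfl
    · exact absurd rfl (CharP.char_ne_one (IsLocalRing.ResidueField O) 1)
    · exact hq
  exact ⟨ZMod.castHom dvd_rfl _⟩

/-- The reduction of a balanced weight with small support is constant on a line and zero
elsewhere. -/
theorem IsBalanced.exists_residue_eq {O : ValuationSubring ℝ} (hO : (p : ℝ) ∈ O.nonunits)
    {D : Finset (Option (ZMod p))} {S : Finset (Plane p)} (hD : D.card ≤ p - 1)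
    (hS : S.card < 2 * D.card) {v : Plane p → O} (hv : IsBalanced D S v) {y : Plane p}
    (hy : IsLocalRing.residue O (v y) ≠ 0) :
    ∃ i ∉ D, ∃ c L, L ≠ 0 ∧
      ∀ z, IsLocalRing.residue O (v z) = if slopeForm i z = c then L else 0 := by
  obtain ⟨ι⟩ := exists_ringHom_residueField hO
  obtain ⟨⟨L, hL⟩, hS0⟩ := hv.map (IsLocalRing.residue O)
  obtain ⟨i, hi, c, hL0, h⟩ := exists_eq_indicator_line ι hL hD hS0 hS fun h0 => hy (congrFun h0 y)
  exact ⟨i, hi, c, L, hL0, h⟩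

/-- A balanced real weight with small support is constant on a line and zero elsewhere. -/
theorem IsBalanced.exists_eq_indicator {D : Finset (Option (ZMod p))} {S : Finset (Plane p)}
    (hp : 3 ≤ p) (hD : D.card ≤ p - 1) (hS : S.card < 2 * D.card) {w : Plane p → ℝ}
    (hw : IsBalanced D S w) (hw0 : w ≠ 0) :
    ∃ i c a, ∀ z, w z = if slopeForm i z = c then a else 0 := by
  obtain ⟨O, hO⟩ := exists_valuationSubring_natCast_mem_nonunits (Fact.out : p.Prime)
  have hDne : D.Nonempty := Finset.card_pos.mp (by omega)
  obtain ⟨v, hv, ⟨x, hx⟩, a, ha, hva⟩ := hw.exists_scaled O hDne hw0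
  obtain ⟨i, hi, c, L, hL, hvL⟩ := hv.exists_residue_eq hO hD hS (y := x) (by simp [hx])
  have hxi : slopeForm i x = c := by
    by_contra hne
    have := hvL x
    rw [hx, if_neg hne, map_one] at this
    exact one_ne_zero this
  -- The whole line lies in `S`, so the difference below is still supported in `S` and the
  -- cardinality bound persists.
  have hline : ∀ z, slopeForm i z = c → z ∈ S := by
    intro z hz
    by_contra hzS
    have := hvL z
    rw [hv.2 z hzS, map_zero, if_pos hz] at this
    exact hL this.symm
  have hu := (hv.map O.subtype).sub (isBalanced_indicator hi hline (1 : ℝ))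
  by_cases hu0 : (fun z => O.subtype (v z) - if slopeForm i z = c then 1 else 0) = 0
  · refine ⟨i, c, a⁻¹, fun z => ?_⟩
    have h1 : (v z : ℝ) = if slopeForm i z = c then 1 else 0 := sub_eq_zero.mp (congrFun hu0 z)
    rw [hva] at h1
    rw [← inv_mul_cancel_left₀ ha (w z), h1]
    split_ifs <;> simp
  exfalso
  obtain ⟨v', hv', ⟨x', hx'⟩, a', -, hva'⟩ := hu.exists_scaled O hDne hu0
  obtain ⟨i', hi', c', L', hL', hvL'⟩ := hv'.exists_residue_eq hO hD hS (y := x') (by simp [hx'])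
  -- As `v x = 1` exactly, the subtraction vanishes at `x`; so the second line misses `x` and
  -- differs from the first.
  have hv'x : v' x = 0 := by
    refine Subtype.ext ?_
    rw [hva', hxi, hx]
    simp
  have hxi' : slopeForm i' x ≠ c' := by
    intro h
    have := hvL' x
    rw [hv'x, map_zero, if_pos h] at this
    exact hL' this.symm
  obtain ⟨y, hy', hy⟩ : ∃ y, slopeForm i' y = c' ∧ slopeForm i y ≠ c := by
    by_contra! hall
    exact hxi' (slopeForm_level_subset hall x hxi)
  have hvx : IsLocalRing.residue O (v x) = L := by rw [hvL, if_pos hxi]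
  have hvy : IsLocalRing.residue O (v y) = 0 := by rw [hvL, if_neg hy]
  have hv'y : IsLocalRing.residue O (v' y) = L' := by rw [hvL', if_pos hy']
  -- The reduction of `v + v'` takes a single nonzero value; it is `L` at `x` and `L'` at `y`.
  have hadd : L = L' := by
    obtain ⟨j, -, e, M, -, h⟩ := (hv.add hv').exists_residue_eq hO hD hS (y := x)
      (by rw [hv'x, add_zero, hvx]; exact hL)
    have h1 := h x
    have h2 := h y
    rw [hv'x, add_zero, hvx] at h1
    rw [map_add, hvy, hv'y, zero_add] at h2
    split_ifs at h1 h2 <;> simp_all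
  have hsub : L = -L' := by
    obtain ⟨j, -, e, M, -, h⟩ := (hv.sub hv').exists_residue_eq hO hD hS (y := x)
      (by rw [hv'x, sub_zero, hvx]; exact hL)
    have h1 := h x
    have h2 := h y
    rw [hv'x, sub_zero, hvx] at h1
    rw [map_sub, hvy, hv'y, zero_sub] at h2
    split_ifs at h1 h2 with g1 g2
    · rw [h1, h2]
    · exact absurd (neg_eq_zero.mp h2) hL'
    · exact absurd h1 hL
    · exact absurd h1 hL
  obtain ⟨ι⟩ := exists_ringHom_residueField hO
  have h2 : (2 : IsLocalRing.ResidueField O) ≠ 0 := by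
    have h2' : ((2 : ℕ) : ZMod p) ≠ 0 := by
      rw [Ne, ZMod.natCast_eq_zero_iff]
      exact Nat.not_dvd_of_pos_of_lt two_pos (by omega)
    have := (map_ne_zero ι).mpr h2'
    rwa [map_natCast, Nat.cast_ofNat] at this
  have : (2 : IsLocalRing.ResidueField O) * L' = 0 := by
    rw [two_mul]
    nth_rewrite 1 [← hadd]
    rw [hsub, neg_add_cancel]
  exact (mul_ne_zero h2 hL') this

end Valuation

/-! ### Counting perfect directions, including the extreme cases. -/

section PerfectDirections

variable {p : ℕ} [Fact p.Prime]

theorem ncard_perfectDirections (w : Plane p → ℝ) :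
    (perfectDirections w).ncard =
      (Finset.univ.filter fun i => ∀ c, levelMass w i c = 1 / (p : ℝ) * ∑ z, w z).card := by
  have : perfectDirections w = directionEquiv '' (Finset.univ.filter fun i =>
      ∀ c, levelMass w i c = 1 / (p : ℝ) * ∑ z, w z : Finset (Option (ZMod p))) := by
    ext d
    obtain ⟨i, rfl⟩ := directionEquiv.surjective d
    rw [directionEquiv.injective.mem_set_image]
    simpa [perfectDirections] using isPerfect_directionEquiv_iff w i
  rw [this, Set.ncard_image_of_injective _ directionEquiv.injective, Set.ncard_coe_finset]

/-- If at most one direction fails to be perfect, then the weight is determined by the masses of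
the lines in that direction. -/
theorem mul_eq_levelMass {w : Plane p → ℝ} {i₀ : Option (ZMod p)}
    (h : ∀ i ≠ i₀, ∀ c, levelMass w i c = 1 / (p : ℝ) * ∑ z, w z) (z : Plane p) :
    p * w z = levelMass w i₀ (slopeForm i₀ z) := by
  have hp : (p : ℝ) ≠ 0 := Nat.cast_ne_zero.mpr (Fact.out : p.Prime).ne_zero
  have hsum := sum_levelMass w z
  rw [← Finset.add_sum_erase _ _ (Finset.mem_univ i₀),
    Finset.sum_congr rfl fun i hi => h i (Finset.ne_of_mem_erase hi) _] at hsum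
  simp only [Finset.sum_const, Finset.card_erase_of_mem (Finset.mem_univ i₀), Finset.card_univ,
    Fintype.card_option, ZMod.card, Nat.add_sub_cancel, nsmul_eq_mul] at hsum
  rw [← mul_assoc, mul_one_div_cancel hp, one_mul] at hsum
  linarith

theorem card_perfect_le_of_not_isConstantOnLine (hp : 3 ≤ p) {w : Plane p → ℝ} (hw : w ≠ 0)
    (hc : ¬ IsConstantOnLine w (Function.support w)) :
    2 * (Finset.univ.filter fun i => ∀ c, levelMass w i c = 1 / (p : ℝ) * ∑ z, w z).card ≤
      (Finset.univ.filter fun z => w z ≠ 0).card := by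
  classical
  set P := Finset.univ.filter fun i => ∀ c, levelMass w i c = 1 / (p : ℝ) * ∑ z, w z with hP
  set T := Finset.univ.filter fun z => w z ≠ 0 with hT
  have hmem : ∀ i, i ∈ P ↔ ∀ c, levelMass w i c = 1 / (p : ℝ) * ∑ z, w z := by simp [hP]
  obtain ⟨x, hx⟩ : ∃ x, w x ≠ 0 := Function.ne_iff.mp hw
  rcases le_or_gt P.card (p - 1) with hsmall | hlarge
  · by_contra! hlt
    have hbal : IsBalanced P T w :=
      ⟨⟨_, fun i hi => (hmem i).mp hi⟩, fun z hz => by simpa [hT] using hz⟩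
    obtain ⟨i, c, a, h⟩ := hbal.exists_eq_indicator hp hsmall hlt hw
    refine hc ((isConstantOnLine_iff _ _).mpr ⟨⟨i, c, ?_⟩, a, ?_⟩)
    · have ha : a ≠ 0 := by
        rintro rfl
        exact hx (by simp [h])
      ext z
      simp [h, ha]
    · intro z hz
      rw [Function.mem_support, h] at hz
      rw [h]
      split_ifs at hz ⊢ with hzc
      · rfl
      · exact absurd rfl hz
  have hfull : (Finset.univ : Finset (Option (ZMod p))).card = p + 1 := by
    rw [Finset.card_univ, Fintype.card_option, ZMod.card]
  by_cases hall : ∀ i, i ∈ P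
  · have hT' : T = Finset.univ := by
      refine Finset.filter_true_of_mem fun z _ => ?_
      have h1 := mul_eq_levelMass (i₀ := none) (fun i _ => (hmem i).mp (hall i)) z
      have h2 := mul_eq_levelMass (i₀ := none) (fun i _ => (hmem i).mp (hall i)) x
      rw [(hmem _).mp (hall none)] at h1 h2
      have hp0 : (p : ℝ) ≠ 0 := Nat.cast_ne_zero.mpr (by omega)
      rwa [mul_left_cancel₀ hp0 (h1.trans h2.symm)]
    have hle : P.card ≤ p + 1 := hfull ▸ Finset.card_le_univ P
    rw [hT', Finset.card_univ]
    simp only [Fintype.card_fun, ZMod.card, Fintype.card_fin]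
    -- This is `2 * (p + 1) ≤ p ^ 2`, which needs `3 ≤ p`.
    nlinarith
  push Not at hall
  obtain ⟨i₀, hi₀⟩ := hall
  have hPle : P ⊆ Finset.univ.erase i₀ := fun i hi =>
    Finset.mem_erase.mpr ⟨fun h => hi₀ (h ▸ hi), Finset.mem_univ _⟩
  have hcard : (Finset.univ.erase i₀).card = p := by
    rw [Finset.card_erase_of_mem (Finset.mem_univ _), hfull, Nat.add_sub_cancel]
  have hPeq : P = Finset.univ.erase i₀ := Finset.eq_of_subset_of_card_le hPle (by omega)
  have hwm := mul_eq_levelMass (w := w) (i₀ := i₀) fun i hi =>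
    (hmem i).mp (hPeq ▸ Finset.mem_erase.mpr ⟨hi, Finset.mem_univ _⟩)
  have hconst : ∀ y z, slopeForm i₀ y = slopeForm i₀ z → w y = w z := by
    intro y z hyz
    have hp0 : (p : ℝ) ≠ 0 := Nat.cast_ne_zero.mpr (by omega)
    exact mul_left_cancel₀ hp0 (by rw [hwm y, hwm z, hyz])
  -- Since `w` is constant on the lines of the one imperfect direction, a support beyond a single
  -- line contains two parallel lines, hence `2 * p` points.
  obtain ⟨y, hy, hyx⟩ : ∃ y, w y ≠ 0 ∧ slopeForm i₀ y ≠ slopeForm i₀ x := by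
    by_contra! hno
    refine hc ((isConstantOnLine_iff _ _).mpr ⟨⟨i₀, slopeForm i₀ x, ?_⟩, w x, fun z hz =>
      hconst _ _ (hno z hz)⟩)
    ext z
    refine ⟨fun hz => hno z hz, fun hz => ?_⟩
    rw [Function.mem_support, hconst z x hz]
    exact hx
  have hlevel : ∀ z, w z ≠ 0 →
      (Finset.univ.filter fun t : Plane p => slopeForm i₀ t = slopeForm i₀ z) ⊆ T := by
    intro z hz t ht
    rw [hT, Finset.mem_filter]
    exact ⟨Finset.mem_univ _, by rwa [hconst t z (Finset.mem_filter.mp ht).2]⟩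
  have hdisj : Disjoint (Finset.univ.filter fun t : Plane p => slopeForm i₀ t = slopeForm i₀ x)
      (Finset.univ.filter fun t : Plane p => slopeForm i₀ t = slopeForm i₀ y) := by
    rw [Finset.disjoint_filter]
    intro t _ h1 h2
    exact hyx (h2.symm.trans h1)
  have := Finset.card_le_card (Finset.union_subset (hlevel x hx) (hlevel y hy))
  rw [Finset.card_union_of_disjoint hdisj, card_slopeForm_eq, card_slopeForm_eq] at this
  rw [hPeq, hcard]
  omega

theorem card_perfect_indicator (i : Option (ZMod p)) (c : ZMod p) {a : ℝ} (ha : a ≠ 0)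
    {w : Plane p → ℝ} (hw : w = fun z => if slopeForm i z = c then a else 0) :
    (Finset.univ.filter fun j => ∀ d, levelMass w j d = 1 / (p : ℝ) * ∑ z, w z).card = p := by
  classical
  have hmass : ∀ j ≠ i, ∀ d, levelMass w j d = a := by
    intro j hj d
    rw [hw]
    exact levelMass_indicator_of_ne hj d c a
  obtain ⟨j₀, hj₀⟩ := exists_ne i
  have htotal : 1 / (p : ℝ) * ∑ z, w z = a := by
    have hp0 : (p : ℝ) ≠ 0 := Nat.cast_ne_zero.mpr (Fact.out : p.Prime).ne_zero
    rw [← sum_levelMass_level w j₀, Finset.sum_congr rfl fun d _ => hmass j₀ hj₀ d]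
    simp [hp0]
  have : (Finset.univ.filter fun j => ∀ d, levelMass w j d = 1 / (p : ℝ) * ∑ z, w z)
      = Finset.univ.erase i := by
    ext j
    rw [htotal, Finset.mem_filter, Finset.mem_erase]
    refine ⟨fun h => ⟨?_, Finset.mem_univ _⟩, fun h => ⟨Finset.mem_univ _, hmass j h.1⟩⟩
    rintro rfl
    have h1 := h.2 (c + 1)
    rw [levelMass, Finset.sum_eq_zero] at h1
    · exact ha h1.symm
    · intro z hz
      rw [hw]
      simp [(Finset.mem_filter.mp hz).2]
  rw [this, Finset.card_erase_of_mem (Finset.mem_univ _), Finset.card_univ, Fintype.card_option,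
    ZMod.card, Nat.add_sub_cancel]

end PerfectDirections

theorem theorem1 (p : ℕ) [Fact p.Prime] (hp : 3 ≤ p) (S : Set (Plane p)) (hS : S.Nonempty)
    (w : Plane p → ℝ) (hw : Function.support w = S) :
    (¬ IsConstantOnLine w S →
      ((perfectDirections w).ncard : ℝ) ≤ 1 / 2 * (S.ncard : ℝ)) ∧
    (IsConstantOnLine w S → (perfectDirections w).ncard = p) := by
  subst hw
  rw [ncard_perfectDirections]
  refine ⟨fun hc => ?_, fun hc => ?_⟩
  · have hle := card_perfect_le_of_not_isConstantOnLine hp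
      (Function.support_nonempty_iff.mp hS) hc
    have hT : Function.support w = (Finset.univ.filter fun z => w z ≠ 0 : Finset (Plane p)) := by
      ext z
      simp
    rw [hT, Set.ncard_coe_finset]
    have := (Nat.cast_le (α := ℝ)).mpr hle
    push_cast at this
    linarith
  · obtain ⟨⟨i, c, hic⟩, a, ha⟩ := (isConstantOnLine_iff _ _).mp hc
    obtain ⟨x, hx⟩ := hS
    refine card_perfect_indicator i c (a := a) (ha x hx ▸ hx) (funext fun z => ?_)
    split_ifs with hz
    · exact ha z (by rw [hic]; exact hz)
    · by_contra hne
      have : z ∈ Function.support w := hne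
      rw [hic] at this
      exact hz this
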